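/- Let $A$ be a finite set. A nearest neighbor $\mathbb{Z}^2$ SFT with alphabet $A$ is a nonempty set $X \subseteq A^{\mathbb{Z}^2}$ of the form $X=\{x : (x(t),x(t+\vec e_i)) \text{ is legal in direction } i \text{ for all } t\in\mathbb{Z}^2,\ i\in\{1,2\}\}$, where for each $i \in\{1,2\}$ a set of legal ordered pairs in $A\times A$ is given. For $\epsilon>0$, $X$ is $\epsilon$-full if there is a set $G\subseteq A$ with $|G|>(1-\epsilon)|A|$ such that every $g\in G$ has, in each of the four directions $\pm\vec e_1,\pm\vec e_2$, more than $(1-\epsilon)|A|$ legal neighbors. Let $(\sigma_t x)(s)=x(s+t)$. For a subshift $Y \subseteq A^{\mathbb{Z}^2}$ (a closed shift-invariant set) and a finite $S\subset\mathbb{Z}^2$, let $L_S(Y)=\{y|_S : y\in Y\}$ and, for $u \in L_S(Y)$, let $[u]=\{y\in Y : y|_S=u\}$. The topological entropy is $h(X)=\lim_{n_1,n_2\to\infty}\frac{1}{n_1n_2}\log|L_{[1,n_1]\times[1,n_2]}(X)|$, and the entropy of a shift-invariant Borel probability measure $\mu$ on $A^{\mathbb{Z}^2}$ is $h(\mu)=\lim_{n_1,n_2\to\infty}\frac{-1}{n_1n_2}\sum_{w\in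 A^{[1,n_1]\times[1,n_2]}}\mu(\{x : x|_{[1,n_1]\times[1,n_2]}=w\})\log\mu(\{x : x|_{[1,n_1]\times[1,n_2]}=w\})$ with $0\log 0=0$. A measure of maximal entropy on $X$ is a shift-invariant Borel probability measure $\mu$ with $\operatorname{supp}\mu\subseteq X$ and $h(\mu)=h(X)$. A subshift $Y$ is block gluing if there is an $n$ such that for all (finite, nonempty) rectangles $S,S'\subset\mathbb{Z}^2$, all $u\in L_S(Y)$ and $u'\in L_{S'}(Y)$, and all $t\in\mathbb{Z}^2$ for which $S$ and $S'-t$ are at $\ell^1$-distance at least $n$, one has $[u]\cap\sigma_t[u']\neq\varnothing$. Theorem. For every $\epsilon>0$ there is an $\epsilon$-full nearest neighbor $\mathbb{Z}^2$ SFT $X$ that has a unique measure of maximal entropy $\mu$, and the support of $\mu$ is not block gluing. -/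

import Mathlib

open MeasureTheory Filter Topology
open SymbolicDynamics.FullShift (shift Subshift)

namespace NearlyFull

/-- Points of the `ℤ^d` full shift over `A`. -/
abbrev Point (d : ℕ) (A : Type*) : Type _ := (Fin d → ℤ) → A

/-- The `ℓ¹` distance on `ℤ^d` (two sites are adjacent iff it equals `1`). -/
def siteDist {d : ℕ} (s t : Fin d → ℤ) : ℤ := ∑ i, |s i - t i|

/-- `L_S(X)`: the configurations of shape `S` that appear in points of `X`. -/
def language {d : ℕ} {A : Type*} (X : Set (Point d A)) (S : Finset (Fin d → ℤ)) :
    Set (S → A) :=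
  {w | ∃ x ∈ X, S.restrict x = w}

/-- The cylinder set `[w]` in `X`: the points of `X` whose restriction to `S` is `w`. -/
def cyl {d : ℕ} {A : Type*} (X : Set (Point d A)) {S : Finset (Fin d → ℤ)} (w : S → A) :
    Set (Point d A) :=
  {x | x ∈ X ∧ S.restrict x = w}

/-- The box `∏ [1, n_i]`. -/
noncomputable def box {d : ℕ} (n : Fin d → ℕ) : Finset (Fin d → ℤ) :=
  Finset.Icc (fun _ => 1) (fun i => (n i : ℤ))

/-- The topological entropy of `X` is `h`. The filter `atTop` on `Fin d → ℕ` says that all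
side lengths tend to infinity. -/
def HasTopEntropy {d : ℕ} {A : Type*} (X : Set (Point d A)) (h : ℝ) : Prop :=
  Tendsto (fun n : Fin d → ℕ =>
    (∏ i, (n i : ℝ))⁻¹ * Real.log ((language X (box n)).ncard : ℝ)) atTop (𝓝 h)

/-- The measure-theoretic entropy of `μ` is `h`. Here `Real.negMulLog p = -p * log p`, with
value `0` at `p = 0`. -/
def HasMeasureEntropy {d : ℕ} {A : Type*} [Fintype A] [MeasurableSpace A]
    (μ : Measure (Point d A)) (h : ℝ) : Prop :=
  Tendsto (fun n : Fin d → ℕ =>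
    (∏ i, (n i : ℝ))⁻¹ * ∑ w : (box n → A), Real.negMulLog (μ.real (cyl Set.univ w)))
    atTop (𝓝 h)

/-- `μ` is a measure of maximal entropy on `X`: a shift-invariant Borel probability measure
whose support is contained in `X` and whose entropy is that of `X`. -/
structure IsMME {d : ℕ} {A : Type*} [Fintype A] [TopologicalSpace A] [MeasurableSpace A]
    (X : Subshift A (Fin d → ℤ)) (μ : Measure (Point d A)) : Prop where
  prob : IsProbabilityMeasure μ
  invariant : ∀ t : Fin d → ℤ, MeasurePreserving (shift t) μ μ
  support_subset : μ.support ⊆ X.carrier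
  entropy_eq : ∃ h : ℝ, HasTopEntropy X.carrier h ∧ HasMeasureEntropy μ h

/-- Adjacency rules for a nearest neighbor `ℤ^d` SFT: `legal i a b` means that `b` may appear
at `t + e_i` when `a` appears at `t`. The forbidden pairs in direction `i` are those for which
`legal i` fails. -/
structure NNRules (d : ℕ) (A : Type*) where
  legal : Fin d → A → A → Prop

/-- The nearest neighbor `ℤ^d` SFT given by adjacency rules. -/
def NNRules.sft {d : ℕ} {A : Type*} [TopologicalSpace A] [DiscreteTopology A]
    (R : NNRules d A) : Subshift A (Fin d → ℤ) where
  carrier := {x | ∀ (t : Fin d → ℤ) (i : Fin d), R.legal i (x t) (x (t + Pi.single i 1))}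
  isClosed := by
    simp only [Set.ofPred_forall]
    refine isClosed_iInter fun t => isClosed_iInter fun i => ?_
    have h : Continuous fun x : Point d A => (x t, x (t + Pi.single i 1)) := by fun_prop
    exact (isClosed_discrete {p : A × A | R.legal i p.1 p.2}).preimage h
  mapsTo := by
    intro g x hx t i
    have h := hx (g + t) i
    rw [add_assoc] at h
    exact h

/-- `ε`-fullness. The bad letters are those not in `G`; the two cardinalities in `neighbors`
count the legal neighbors of `g` in the directions `e_i` and `-e_i`. -/
def NNRules.IsFull {d : ℕ} {A : Type*} [Fintype A] (R : NNRules d A) (ε : ℝ) : Prop :=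
  ∃ G : Set A, (1 - ε) * Fintype.card A < G.ncard ∧
    ∀ g ∈ G, ∀ i : Fin d,
      (1 - ε) * Fintype.card A < {a | R.legal i g a}.ncard ∧
      (1 - ε) * Fintype.card A < {a | R.legal i a g}.ncard

/-- Block gluing: for some `n`, any two configurations `u`, `u'` in the language of `X` whose
shapes are boxes, and any `t` such that the shape of `u` and the shape of `σ_t u'` (the shape of
`u'` translated by `-t`) are at distance at least `n`, satisfy `[u] ∩ σ_t [u'] ≠ ∅`. -/
def BlockGluing {d : ℕ} {A : Type*} (X : Set (Point d A)) : Prop :=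
  ∃ n : ℕ, ∀ a b a' b' : Fin d → ℤ, a ≤ b → a' ≤ b' →
    ∀ u ∈ language X (Finset.Icc a b), ∀ u' ∈ language X (Finset.Icc a' b'),
    ∀ t : Fin d → ℤ,
      (∀ s ∈ Finset.Icc a b, ∀ s' ∈ Finset.Icc a' b', (n : ℤ) ≤ siteDist s (s' - t)) →
      (cyl X u ∩ shift t '' cyl X u').Nonempty

end NearlyFull

/-! Forget the marks of a special letter and keep only its colour: one colour for all special
letters, one for each free letter, `N + 1` in total. A special letter is determined by its left and
lower neighbors, a free letter by nothing, so a point of the SFT is determined by its colours at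
every site from which each leftward or downward chain of special letters ends. Only 12 letters are
special, so a large `N` gives fullness.

Uniqueness. A pattern on a box is determined by its colours together with its left column and bottom
row (`eqOn_of_colour_eq`). The marks therefore contribute only a boundary term, and the entropy is
`log (N + 1)`. The Gibbs inequality, applied to products of the law of a single tile, shows that a
measure of maximal entropy has uniform colours on every tile (`measure_tile_of_hasMeasureEntropy`),
so its colours are uniform Bernoulli. Since `2 / (N + 1) < 1`, a union bound over chains shows that
almost surely none is infinite (`ae_exists_not_hasChain`). The marks are then a function `decode` of
the colours, so the measure is unique (`eq_triangleMeasure`).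

No block gluing. The marks let a triangle of special letters be recognised from one of its rows:
inner marks followed by an edge mark force a row of the same kind, one site shorter, directly below.
A row of width `n + 1` thus forces a special letter `n + 1` sites below its left end
(`IsTriangleRow.colour_eq_zero`), which excludes a free letter there. Both patterns occur in the
support, because a point whose special letters lie in the first quadrant has its marks fixed by
finitely many colours (`mem_support_triangleMeasure`). -/

namespace NearlyFull

/-! ### The alphabet, its marks and its colours -/

/-- The marks carried by special letters. Inside a triangle of special letters, `edge` marks the
cells directly above the diagonal, `inner` the cells further up, and `base` everything else. -/
inductive State
  | base
  | edge
  | inner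

instance : Fintype State :=
  ⟨⟨↑[State.base, State.edge, State.inner], by simp⟩, fun s => by cases s <;> simp⟩

/-- The alphabet: `N` free letters, and special letters `(p, q)` which record the mark `p` of the
letter to the left and a mark `q` computed from the letter below. -/
def Letter (N : ℕ) : Type := Fin N ⊕ (Option State × State)

namespace Letter

variable {N : ℕ}

instance : Fintype (Letter N) := inferInstanceAs (Fintype (Fin N ⊕ (Option State × State)))
instance : TopologicalSpace (Letter N) := ⊥
instance : DiscreteTopology (Letter N) := ⟨rfl⟩
instance : MeasurableSpace (Letter N) := ⊤
instance : DiscreteMeasurableSpace (Letter N) := ⟨fun _ => trivial⟩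
instance : BorelSpace (Letter N) := ⟨by rw [borel_eq_top_of_discrete]; rfl⟩

/-- The free letters. -/
def free (i : Fin N) : Letter N := Sum.inl i

/-- The special letters. -/
def special (p : Option State) (q : State) : Letter N := Sum.inr (p, q)

/-- The information about a letter that is passed to a special letter on its right. -/
def hMark : Letter N → Option State
  | Sum.inl _ => none
  | Sum.inr (_, q) => some q

/-- The information about a letter that is passed to a special letter above it. -/
def vMark : Letter N → State
  | Sum.inl _ => .base
  | Sum.inr (none, .base) => .edge
  | Sum.inr (some .edge, .base) => .edge
  | Sum.inr (none, .edge) => .inner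
  | Sum.inr (none, .inner) => .inner
  | Sum.inr (some .inner, .edge) => .inner
  | Sum.inr (some .inner, .inner) => .inner
  | Sum.inr _ => .base

/-- The colour of a letter: `0` for special letters, `i + 1` for the free letter `i`. -/
def colour : Letter N → Fin (N + 1)
  | Sum.inl i => i.succ
  | Sum.inr _ => 0

/-- The letter of colour `c` that fits to the right of `a` and above `b`. -/
def fit (c : Fin (N + 1)) (a b : Letter N) : Letter N :=
  Fin.cases (special (hMark a) (vMark b)) free c

@[simp] lemma fit_zero (a b : Letter N) : fit 0 a b = special (hMark a) (vMark b) := rfl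

@[simp] lemma fit_succ (i : Fin N) (a b : Letter N) : fit i.succ a b = free i := rfl

lemma fit_of_ne_zero {c : Fin (N + 1)} (hc : c ≠ 0) (a b a' b' : Letter N) :
    fit c a b = fit c a' b' := by
  obtain ⟨i, rfl⟩ := Fin.exists_succ_eq.2 hc
  rfl

@[simp] lemma colour_fit (c : Fin (N + 1)) (a b : Letter N) : colour (fit c a b) = c := by
  refine Fin.cases ?_ (fun i => ?_) c <;> rfl

lemma card_eq : Fintype.card (Letter N) = N + 12 := by
  have : Fintype.card (Letter N) = Fintype.card (Fin N ⊕ (Option State × State)) := rfl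
  rw [this, Fintype.card_sum, Fintype.card_fin]
  rfl

end Letter

open Letter

/-! ### The SFT and its fullness -/

/-- Free letters are legal everywhere; a special letter has to carry the marks of the letters to
its left and below it. -/
def triangleRules (N : ℕ) : NNRules 2 (Letter N) where
  legal i a b := match b with
    | Sum.inl _ => True
    | Sum.inr (p, q) => if i = 0 then p = hMark a else q = vMark a

/-- The left (`i = 0`) or lower (`i = 1`) neighbor of a site. -/
def pred (i : Fin 2) (t : Fin 2 → ℤ) : Fin 2 → ℤ := t - Pi.single i 1

lemma mem_sft_iff {N : ℕ} {x : Point 2 (Letter N)} :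
    x ∈ (triangleRules N).sft.carrier ↔
      ∀ t, x t = fit (colour (x t)) (x (pred 0 t)) (x (pred 1 t)) := by
  constructor
  · intro h t
    have h0 := h (pred 0 t) 0
    have h1 := h (pred 1 t) 1
    simp only [pred, sub_add_cancel] at h0 h1
    simp only [pred]
    revert h0 h1
    generalize x t = c
    rcases c with i | ⟨p, q⟩
    · intros; rfl
    · simp only [triangleRules]
      intro h0 h1
      simp only [if_true] at h0
      simp only [one_ne_zero, if_false] at h1
      subst h0 h1
      rfl
  · intro h t i
    have ht := h (t + Pi.single i 1)
    have hp : pred i (t + Pi.single i 1) = t := add_sub_cancel_right _ _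
    rcases hc : x (t + Pi.single i 1) with j | ⟨p, q⟩
    · trivial
    · rw [hc] at ht
      have h' : (p, q) = _ := Sum.inr.inj ht
      obtain ⟨h0, h1⟩ := Prod.mk.inj h'
      match i with
      | 0 => rw [hp] at h0; exact h0
      | 1 => rw [hp] at h1; exact h1

lemma isFull_triangleRules {N : ℕ} {ε : ℝ} (hN : 12 < ε * (N + 12)) :
    (triangleRules N).IsFull ε := by
  -- All but 12 letters are free, and `hN` says exactly that `N > (1 - ε) * (N + 12)`.
  have key : ∀ S : Set (Letter N), Set.range (free (N := N)) ⊆ S →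
      (1 - ε) * Fintype.card (Letter N) < S.ncard := by
    intro S hS
    have h1 : N ≤ S.ncard := by
      have := Set.ncard_le_ncard hS (Set.toFinite S)
      have hinj : Function.Injective (free (N := N)) := fun a b h => Sum.inl.inj h
      rwa [Set.ncard_range_of_injective hinj, Nat.card_fin] at this
    have h2 : (N : ℝ) ≤ S.ncard := by exact_mod_cast h1
    rw [card_eq]
    push_cast
    linarith
  refine ⟨Set.range free, key _ subset_rfl, ?_⟩
  rintro _ ⟨g, rfl⟩ i
  refine ⟨key _ ?_, key _ ?_⟩
  · rintro _ ⟨j, rfl⟩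
    trivial
  · rintro a -
    trivial

/-! ### Propagation of marks along chains of special letters -/

/-- One update step towards a point of the SFT with colours `U`. -/
def step {N : ℕ} (U : Point 2 (Fin (N + 1))) (x : Point 2 (Letter N)) : Point 2 (Letter N) :=
  fun t => fit (U t) (x (pred 0 t)) (x (pred 1 t))

/-- There is a chain of special letters from `t` with `n` sites, each a left or lower neighbor of
the one before. -/
def HasChain {N : ℕ} (U : Point 2 (Fin (N + 1))) : ℕ → (Fin 2 → ℤ) → Prop
  | 0, _ => True
  | n + 1, t => U t = 0 ∧ ∃ i, HasChain U n (pred i t)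

/-- The letter produced at a site depends on earlier values only through a special colour there. A
free colour cuts the dependence, so the starting configuration matters only along a chain of full
length. -/
lemma iterate_step_eq_of_not_hasChain {N : ℕ} {U : Point 2 (Fin (N + 1))} {n : ℕ}
    {t : Fin 2 → ℤ} (h : ¬ HasChain U n t) (x y : Point 2 (Letter N)) :
    (step U)^[n] x t = (step U)^[n] y t := by
  induction n generalizing t with
  | zero => exact absurd trivial h
  | succ n ih =>
    rw [Function.iterate_succ_apply', Function.iterate_succ_apply']
    by_cases hU : U t = 0
    · have h' : ∀ i, ¬ HasChain U n (pred i t) := fun i hi => h ⟨hU, i, hi⟩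
      simp only [step, ih (h' 0), ih (h' 1)]
    · exact fit_of_ne_zero hU _ _ _ _

lemma step_eq_self {N : ℕ} {x : Point 2 (Letter N)} (hx : x ∈ (triangleRules N).sft.carrier) :
    step (fun t => colour (x t)) x = x :=
  funext fun t => (mem_sft_iff.1 hx t).symm

lemma mem_sft_of_step_eq_self {N : ℕ} {U : Point 2 (Fin (N + 1))} {x : Point 2 (Letter N)}
    (h : step U x = x) : x ∈ (triangleRules N).sft.carrier := by
  refine mem_sft_iff.2 fun t => ?_
  have ht : fit (U t) (x (pred 0 t)) (x (pred 1 t)) = x t := congrFun h t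
  conv_rhs => rw [← ht]
  rw [colour_fit, ht]

/-- Two points of the SFT with the same colours on a box agree on the box if they agree on its left
column and its bottom row. -/
lemma eqOn_of_colour_eq {N : ℕ} {x y : Point 2 (Letter N)}
    (hx : x ∈ (triangleRules N).sft.carrier) (hy : y ∈ (triangleRules N).sft.carrier)
    {a b : Fin 2 → ℤ} (hc : ∀ t ∈ Finset.Icc a b, colour (x t) = colour (y t))
    (he : ∀ t ∈ Finset.Icc a b, ∀ i, t i = a i → x t = y t) :
    ∀ t ∈ Finset.Icc a b, x t = y t := by
  -- Induction over antidiagonals: both predecessors of a site lie on the previous one.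
  have main : ∀ n : ℕ, ∀ t ∈ Finset.Icc a b, (t 0 - a 0) + (t 1 - a 1) ≤ n → x t = y t := by
    intro n
    induction n with
    | zero =>
      intro t ht hn
      have h := Finset.mem_Icc.1 ht
      have h0 : a 0 ≤ t 0 := h.1 0
      have h1 : a 1 ≤ t 1 := h.1 1
      exact he t ht 0 (by push_cast at hn; omega)
    | succ n ih =>
      intro t ht hn
      by_cases ha : ∃ i, t i = a i
      · obtain ⟨i, hi⟩ := ha
        exact he t ht i hi
      · push Not at ha
        have h := Finset.mem_Icc.1 ht
        have hp : ∀ i, pred i t ∈ Finset.Icc a b := by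
          intro i
          refine Finset.mem_Icc.2 ⟨fun j => ?_, fun j => ?_⟩
          · have : a j ≤ t j := h.1 j
            have := ha j
            by_cases hij : j = i
            · subst hij; simp [pred]; omega
            · simp [pred, hij]; omega
          · have : t j ≤ b j := h.2 j
            by_cases hij : j = i
            · subst hij; simp [pred]; omega
            · simp [pred, hij]; omega
        rw [mem_sft_iff.1 hx t, mem_sft_iff.1 hy t, hc t ht,
          ih _ (hp 0) (by simp [pred]; push_cast at hn; omega),
          ih _ (hp 1) (by simp [pred]; push_cast at hn; omega)]
  intro t ht
  have h := Finset.mem_Icc.1 ht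
  have h0 : a 0 ≤ t 0 := h.1 0
  have h1 : a 1 ≤ t 1 := h.1 1
  exact main ((t 0 - a 0) + (t 1 - a 1)).toNat t ht (by omega)

/-! ### Triangles and the special letters they force -/

/-- The mark of the cell `(i, j)`, `0 ≤ i ≤ j`, of the triangle. -/
def triangleMark (i j : ℤ) : State :=
  if i = j then .base else if i = j - 1 then .edge else .inner

/-- The point with special letters at the sites `(i, j)` with `0 ≤ i ≤ j` and the free letter `a`
elsewhere. -/
def trianglePoint {N : ℕ} (a : Fin N) : Point 2 (Letter N) := fun t =>
  if 0 ≤ t 0 ∧ t 0 ≤ t 1 then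
    special (if t 0 = 0 then none else some (triangleMark (t 0 - 1) (t 1)))
      (triangleMark (t 0) (t 1))
  else free a

@[simp] lemma hMark_free {N : ℕ} (a : Fin N) : hMark (free a) = none := rfl

@[simp] lemma hMark_special {N : ℕ} (p : Option State) (q : State) :
    hMark (special p q : Letter N) = some q := rfl

@[simp] lemma vMark_free {N : ℕ} (a : Fin N) : vMark (free a) = .base := rfl

@[simp] lemma colour_special {N : ℕ} (p : Option State) (q : State) :
    colour (special p q : Letter N) = 0 := rfl

@[simp] lemma colour_free {N : ℕ} (a : Fin N) : colour (free a) = a.succ := rfl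

lemma trianglePoint_mem_sft {N : ℕ} (a : Fin N) :
    trianglePoint a ∈ (triangleRules N).sft.carrier := by
  refine mem_sft_iff.2 fun t => ?_
  by_cases ht : 0 ≤ t 0 ∧ t 0 ≤ t 1
  · have hl : hMark (trianglePoint a (pred 0 t)) =
        if t 0 = 0 then none else some (triangleMark (t 0 - 1) (t 1)) := by
      by_cases h0 : t 0 = 0
      · simp [trianglePoint, pred, h0]
      · have : 1 ≤ t 0 ∧ t 0 ≤ t 1 + 1 := by omega
        simp [trianglePoint, pred, h0, this]
    have hv : vMark (trianglePoint a (pred 1 t)) = triangleMark (t 0) (t 1) := by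
      by_cases h1 : t 0 = t 1
      · simp [trianglePoint, pred, h1, triangleMark]
      · have h2 : 0 ≤ t 0 ∧ t 0 ≤ t 1 - 1 := by omega
        have hb : trianglePoint a (pred 1 t) = special (if t 0 = 0 then none else
            some (triangleMark (t 0 - 1) (t 1 - 1))) (triangleMark (t 0) (t 1 - 1)) := by
          simp [trianglePoint, pred, h2]
        have h4 : t 0 - 1 ≠ t 1 - 1 := by omega
        rw [hb]
        by_cases h3 : t 0 = t 1 - 1
        · have h5 : t 0 - 1 = t 1 - 1 - 1 := by omega
          simp only [triangleMark, if_neg h1, if_pos h3, if_neg h4, if_pos h5]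
          split_ifs <;> rfl
        · have h5 : t 0 - 1 ≠ t 1 - 1 - 1 := by omega
          simp only [triangleMark, if_neg h1, if_neg h3, if_neg h4, if_neg h5]
          split_ifs <;> rfl
    have : trianglePoint a t = special (if t 0 = 0 then none else
        some (triangleMark (t 0 - 1) (t 1))) (triangleMark (t 0) (t 1)) := if_pos ht
    rw [this, colour_special, fit_zero, hl, hv]
  · have : trianglePoint a t = free a := if_neg ht
    rw [this, colour_free, fit_succ]

/-- This and `vMark_eq_inner` invert `vMark`, so that marks can be read downwards: a mark other than
`base` certifies that the letter below is special and restricts its marks. -/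
lemma vMark_eq_edge {N : ℕ} {c : Letter N} (h : vMark c = .edge) :
    c = special none .base ∨ c = special (some .edge) .base := by
  rcases c with i | ⟨_ | p, q⟩
  · cases h
  · cases q <;> first | exact .inl rfl | cases h
  · cases p <;> cases q <;> first | exact .inr rfl | cases h

lemma vMark_eq_inner {N : ℕ} {c : Letter N} (h : vMark c = .inner) :
    ∃ p q, c = special p q ∧ (p = none ∨ p = some .inner) ∧ (q = .edge ∨ q = .inner) := by
  rcases c with i | ⟨_ | p, q⟩
  · cases h
  · cases q <;> first | (cases h; done) | exact ⟨_, _, rfl, by simp⟩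
  · cases p <;> cases q <;> first | (cases h; done) | exact ⟨_, _, rfl, by simp⟩

/-- The marks on the row of height `y` are those of the row of width `n + 1` of the triangle. -/
def IsTriangleRow {N : ℕ} (x : Point 2 (Letter N)) (n : ℕ) (y : ℤ) : Prop :=
  (∀ i : ℤ, 0 ≤ i → i < n → hMark (x ![i, y]) = some .inner) ∧ hMark (x ![n, y]) = some .edge

lemma eq_special_of_hMark {N : ℕ} {x : Point 2 (Letter N)}
    (hx : x ∈ (triangleRules N).sft.carrier) {i y : ℤ} {q : State}
    (h : hMark (x ![i, y]) = some q) :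
    x ![i, y] = special (hMark (x ![i - 1, y])) q ∧ vMark (x ![i, y - 1]) = q := by
  have h1 := mem_sft_iff.1 hx ![i, y]
  have e0 : pred 0 ![i, y] = ![i - 1, y] := by ext j; fin_cases j <;> simp [pred]
  have e1 : pred 1 ![i, y] = ![i, y - 1] := by ext j; fin_cases j <;> simp [pred]
  rw [e0, e1] at h1
  revert h1 h
  generalize x ![i, y] = c
  rcases c with j | ⟨p, q'⟩
  · intro h; cases h
  · intro h h1
    obtain rfl : q' = q := Option.some.inj h
    obtain ⟨h2, h3⟩ := Prod.mk.inj (Sum.inr.inj h1)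
    exact ⟨by rw [h2]; rfl, h3.symm⟩

/-- Below inner cells lie special letters whose left mark is `none` or `inner`. The left neighbor is
special as well, except at the left end, so `none` is excluded and that neighbor is inner. Likewise
the letter below the edge cell forces its left neighbor to be an edge cell, so the edge moves one
site to the left. -/
lemma IsTriangleRow.below {N : ℕ} {x : Point 2 (Letter N)}
    (hx : x ∈ (triangleRules N).sft.carrier) {n : ℕ} {y : ℤ} (h : IsTriangleRow x (n + 1) y) :
    IsTriangleRow x n (y - 1) := by
  have hin : ∀ i : ℤ, 0 ≤ i → i < n + 1 → ∃ p q, x ![i, y - 1] = special p q ∧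
      (p = none ∨ p = some .inner) ∧ (q = .edge ∨ q = .inner) := fun i h0 h1 =>
    vMark_eq_inner (eq_special_of_hMark hx (h.1 i h0 (by push_cast; exact h1))).2
  refine ⟨fun i h0 h1 => ?_, ?_⟩
  · obtain ⟨p, q, hpq, -, -⟩ := hin i h0 (by omega)
    obtain ⟨p', q', hpq', hp', -⟩ := hin (i + 1) (by omega) (by omega)
    have h2 := (eq_special_of_hMark hx (by rw [hpq']; rfl)).1
    rw [hpq', add_sub_cancel_right, hpq] at h2
    obtain ⟨h3, -⟩ := Prod.mk.inj (Sum.inr.inj h2)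
    rw [hpq]
    rcases hp' with rfl | rfl
    · cases h3
    · exact h3.symm
  · obtain ⟨p, q, hpq, -, -⟩ := hin n (by omega) (by omega)
    have he := vMark_eq_edge (eq_special_of_hMark hx h.2).2
    push_cast at he
    rcases he with he | he
    all_goals
      have h2 := (eq_special_of_hMark hx (by rw [he]; rfl)).1
      rw [he, add_sub_cancel_right, hpq] at h2
      obtain ⟨h3, -⟩ := Prod.mk.inj (Sum.inr.inj h2)
      rw [hpq]
    · cases h3
    · exact h3.symm

/-- A row of the triangle of width `n + 1` forces a special letter `n + 1` sites below its left
end. -/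
lemma IsTriangleRow.colour_eq_zero {N : ℕ} {x : Point 2 (Letter N)}
    (hx : x ∈ (triangleRules N).sft.carrier) {n : ℕ} {y : ℤ} (h : IsTriangleRow x n y) :
    colour (x ![0, y - n - 1]) = 0 := by
  induction n generalizing y with
  | zero =>
    have := vMark_eq_edge (eq_special_of_hMark hx h.2).2
    simp only [Nat.cast_zero, sub_zero] at this ⊢
    rcases this with h | h <;> rw [h] <;> rfl
  | succ n ih =>
    have := ih (h.below hx)
    convert this using 5
    push_cast
    ring

/-- At height `n + 1` the diagonal cell sits in column `n + 1`, just outside the columns `0, …, n`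
that are tested. -/
lemma isTriangleRow_trianglePoint {N : ℕ} (a : Fin N) (n : ℕ) :
    IsTriangleRow (trianglePoint a) n (n + 1) := by
  refine ⟨fun i h0 h1 => ?_, ?_⟩
  · have h2 : 0 ≤ i ∧ i ≤ (n : ℤ) + 1 := by omega
    have h3 : i ≠ (n : ℤ) + 1 := by omega
    have h4 : i ≠ (n : ℤ) := by omega
    simp [trianglePoint, triangleMark, h2, h3, h4]
  · have h2 : (n : ℤ) ≤ (n : ℤ) + 1 := by omega
    simp [trianglePoint, triangleMark, h2]

/-! ### Bernoulli colours and the absence of infinite chains -/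

/-- The uniform Bernoulli measure on colour configurations. -/
noncomputable def bernoulli (N : ℕ) : Measure (Point 2 (Fin (N + 1))) :=
  Measure.infinitePi fun _ => ProbabilityTheory.uniformOn Set.univ

instance (N : ℕ) : IsProbabilityMeasure (bernoulli N) := by
  unfold bernoulli; infer_instance

lemma uniformOn_univ_singleton {N : ℕ} (c : Fin (N + 1)) :
    ProbabilityTheory.uniformOn Set.univ {c} = ((N : ENNReal) + 1)⁻¹ := by
  rw [ProbabilityTheory.uniformOn_univ, Measure.count_singleton, Fintype.card_fin, one_div]
  push_cast
  rfl

lemma setOf_pattern_eq_pi {N : ℕ} (S : Finset (Fin 2 → ℤ)) (u : Point 2 (Fin (N + 1))) :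
    {U : Point 2 (Fin (N + 1)) | ∀ s ∈ S, U s = u s} = Set.pi S fun s => {u s} := by
  ext U; simp

lemma measurableSet_pattern {N : ℕ} (S : Finset (Fin 2 → ℤ)) (u : Point 2 (Fin (N + 1))) :
    MeasurableSet {U : Point 2 (Fin (N + 1)) | ∀ s ∈ S, U s = u s} := by
  rw [setOf_pattern_eq_pi]
  exact MeasurableSet.pi S.countable_toSet fun _ _ => MeasurableSet.singleton _

lemma bernoulli_pattern {N : ℕ} (S : Finset (Fin 2 → ℤ)) (u : Point 2 (Fin (N + 1))) :
    bernoulli N {U | ∀ s ∈ S, U s = u s} = ((N : ENNReal) + 1)⁻¹ ^ S.card := by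
  rw [setOf_pattern_eq_pi, bernoulli,
    Measure.infinitePi_pi _ (fun _ _ => MeasurableSet.singleton _)]
  simp [uniformOn_univ_singleton]

lemma measurable_shift {A : Type*} [MeasurableSpace A] (g : Fin 2 → ℤ) :
    Measurable (shift g : Point 2 A → Point 2 A) :=
  measurable_pi_lambda _ fun _ => measurable_pi_apply _

lemma bernoulli_map_shift {N : ℕ} (g : Fin 2 → ℤ) :
    (bernoulli N).map (shift g) = bernoulli N := by
  refine Measure.eq_infinitePi _ fun s t ht => ?_
  rw [Measure.map_apply (measurable_shift g) (MeasurableSet.pi s.countable_toSet fun i _ => ht i)]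
  have : shift g ⁻¹' Set.pi (s : Set (Fin 2 → ℤ)) t =
      Set.pi ((s.map (addLeftEmbedding g) : Finset (Fin 2 → ℤ)) : Set (Fin 2 → ℤ))
        (fun i => t (i - g)) := by
    ext U
    simp only [Set.mem_preimage, Set.mem_pi, Finset.coe_map, Set.forall_mem_image]
    simp
  rw [this, bernoulli, Measure.infinitePi_pi _ (fun i _ => ht _)]
  simp

lemma measurableSet_hasChain {N : ℕ} (n : ℕ) (t : Fin 2 → ℤ) :
    MeasurableSet {U : Point 2 (Fin (N + 1)) | HasChain U n t} := by
  induction n generalizing t with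
  | zero => exact MeasurableSet.univ
  | succ n ih =>
    have h1 : MeasurableSet {U : Point 2 (Fin (N + 1)) | U t = 0} :=
      measurable_pi_apply t (MeasurableSet.singleton 0)
    have h2 := MeasurableSet.iUnion fun i => ih (pred i t)
    convert h1.inter h2 using 1
    ext U
    simp [HasChain]

lemma HasChain.of_succ {N : ℕ} {U : Point 2 (Fin (N + 1))} {n : ℕ} {t : Fin 2 → ℤ}
    (h : HasChain U (n + 1) t) : HasChain U n t := by
  induction n generalizing t with
  | zero => trivial
  | succ n ih => exact ⟨h.1, h.2.imp fun i hi => ih hi⟩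

lemma HasChain.anti {N : ℕ} {U : Point 2 (Fin (N + 1))} {m n : ℕ} (hmn : m ≤ n)
    {t : Fin 2 → ℤ} (h : HasChain U n t) : HasChain U m t := by
  induction hmn with
  | refl => exact h
  | step _ ih => exact ih h.of_succ

lemma pred_sum (i : Fin 2) (t : Fin 2 → ℤ) : pred i t 0 + pred i t 1 = t 0 + t 1 - 1 := by
  fin_cases i <;> simp [pred] <;> ring

/-- Union bound over the two continuations of a chain at each step. The set `S` collects the sites
already visited; they lie on higher antidiagonals, so the next site is always new and contributes an
independent factor. -/
lemma bernoulli_hasChain_inter_le {N : ℕ} (n : ℕ) (t : Fin 2 → ℤ) (S : Finset (Fin 2 → ℤ))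
    (hS : ∀ s ∈ S, t 0 + t 1 < s 0 + s 1) :
    bernoulli N {U | (∀ s ∈ S, U s = 0) ∧ HasChain U n t} ≤
      2 ^ n * ((N : ENNReal) + 1)⁻¹ ^ (S.card + n) := by
  induction n generalizing t S with
  | zero =>
    simp only [HasChain, and_true]
    rw [bernoulli_pattern S fun _ => 0]
    simp
  | succ n ih =>
    have htS : t ∉ S := fun h => lt_irrefl _ (hS t h)
    have hsub : {U : Point 2 (Fin (N + 1)) | (∀ s ∈ S, U s = 0) ∧ HasChain U (n + 1) t} ⊆
        ⋃ i, {U | (∀ s ∈ insert t S, U s = 0) ∧ HasChain U n (pred i t)} := by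
      rintro U ⟨h1, h2, i, h3⟩
      refine Set.mem_iUnion.2 ⟨i, fun s hs => ?_, h3⟩
      rcases Finset.mem_insert.1 hs with rfl | hs
      exacts [h2, h1 s hs]
    refine (measure_mono hsub).trans ((measure_iUnion_le _).trans ?_)
    rw [tsum_fintype]
    calc _ ≤ ∑ _i : Fin 2, 2 ^ n * ((N : ENNReal) + 1)⁻¹ ^ ((insert t S).card + n) := by
          refine Finset.sum_le_sum fun i _ => ih _ _ fun s hs => ?_
          rw [pred_sum]
          rcases Finset.mem_insert.1 hs with rfl | hs
          · omega
          · have := hS s hs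
            omega
      _ = _ := by
          rw [Finset.card_insert_of_notMem htS]
          simp only [Finset.sum_const, Finset.card_univ, Fintype.card_fin, nsmul_eq_mul]
          push_cast
          rw [← mul_assoc, pow_succ' 2 n]
          congr 2
          ring

/-- Almost surely no site starts an infinite chain of special letters. -/
lemma ae_exists_not_hasChain {N : ℕ} (hN : 2 ≤ N) :
    ∀ᵐ U ∂bernoulli N, ∀ t, ∃ n, ¬ HasChain U n t := by
  rw [ae_all_iff]
  intro t
  rw [ae_iff]
  push Not
  have hlim : Tendsto (fun n : ℕ => (2 * ((N : ENNReal) + 1)⁻¹) ^ n) atTop (𝓝 0) := by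
    refine ENNReal.tendsto_pow_atTop_nhds_zero_of_lt_one ?_
    rw [← div_eq_mul_inv]
    refine (ENNReal.div_lt_iff (by simp) (by simp)).2 ?_
    rw [one_mul]
    have : 2 < N + 1 := by omega
    exact_mod_cast this
  refine le_antisymm (ge_of_tendsto' hlim fun n => ?_) zero_le
  refine (measure_mono ?_).trans ((bernoulli_hasChain_inter_le n t ∅ (by simp)).trans ?_)
  · intro U hU
    exact ⟨by simp, hU n⟩
  · simp [mul_pow]

/-! ### Recovering a point from its colours -/

lemma exists_not_hasChain_or {N : ℕ} (t : Fin 2 → ℤ) (U : Point 2 (Fin (N + 1))) :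
    ∃ n, ¬ HasChain U n t ∨ ∀ m, HasChain U m t := by
  by_cases h : ∀ m, HasChain U m t
  · exact ⟨0, .inr h⟩
  · push Not at h
    exact h.imp fun _ => .inl

open Classical in
/-- The point of the SFT with colours `U`, if all chains of special letters are finite. -/
noncomputable def decode {N : ℕ} (U : Point 2 (Fin (N + 1))) : Point 2 (Letter N) := fun t =>
  (step U)^[Nat.find (exists_not_hasChain_or t U)] (fun _ => special none .base) t

-- Once `n` exceeds the length of all chains from `t`, neither the starting configuration nor
-- further iterations affect the letter at `t`. The value of `decode` at the start of an infinite
-- chain is arbitrary and plays no role.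
open Classical in
lemma decode_eq {N : ℕ} {U : Point 2 (Fin (N + 1))} {n : ℕ} {t : Fin 2 → ℤ}
    (h : ¬ HasChain U n t) (x : Point 2 (Letter N)) : decode U t = (step U)^[n] x t := by
  obtain ⟨k, hk, hd⟩ : ∃ k, (¬ HasChain U k t ∨ ∀ m, HasChain U m t) ∧
      decode U t = (step U)^[k] (fun _ => special none .base) t :=
    ⟨_, Nat.find_spec (exists_not_hasChain_or t U), rfl⟩
  replace hk := hk.resolve_right fun h' => h (h' n)
  rw [hd]
  rcases le_total k n with hkn | hkn
  · obtain ⟨d, rfl⟩ := Nat.exists_eq_add_of_le hkn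
    rw [Function.iterate_add_apply]
    exact iterate_step_eq_of_not_hasChain hk _ _
  · obtain ⟨d, rfl⟩ := Nat.exists_eq_add_of_le hkn
    rw [Function.iterate_add_apply]
    exact iterate_step_eq_of_not_hasChain h _ _

lemma measurable_iterate_step {N : ℕ} (n : ℕ) (x : Point 2 (Letter N)) (t : Fin 2 → ℤ) :
    Measurable fun U : Point 2 (Fin (N + 1)) => (step U)^[n] x t := by
  induction n generalizing t with
  | zero => exact measurable_const
  | succ n ih =>
    simp only [Function.iterate_succ_apply']
    have hf : Measurable fun p : Fin (N + 1) × Letter N × Letter N => fit p.1 p.2.1 p.2.2 :=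
      Measurable.of_discrete
    exact hf.comp ((measurable_pi_apply t).prodMk ((ih (pred 0 t)).prodMk (ih (pred 1 t))))

open Classical in
lemma measurable_decode {N : ℕ} : Measurable (decode (N := N)) := by
  refine measurable_pi_lambda _ fun t => ?_
  have h : MeasurableSet {U : Point 2 (Fin (N + 1)) | ∀ m, HasChain U m t} := by
    rw [Set.ofPred_forall]
    exact MeasurableSet.iInter fun m => measurableSet_hasChain m t
  exact Measurable.find (f := fun n U => (step U)^[n] (fun _ => special none .base) t)
    (p := fun n U => ¬ HasChain (N := N) U n t ∨ ∀ m, HasChain U m t)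
    (fun n => measurable_iterate_step n _ t)
    (fun n => (measurableSet_hasChain n t).compl.union h)
    (exists_not_hasChain_or t)

lemma step_decode {N : ℕ} {U : Point 2 (Fin (N + 1))} (h : ∀ t, ∃ n, ¬ HasChain U n t) :
    step U (decode U) = decode U := by
  funext t
  choose k hk using h
  -- One number of iterations that suffices at `t` and at both its predecessors.
  set n := max (k (pred 0 t)) (k (pred 1 t)) + k t with hn
  have h0 : ¬ HasChain U n (pred 0 t) := fun h' => hk _ (h'.anti (by omega))
  have h1 : ¬ HasChain U n (pred 1 t) := fun h' => hk _ (h'.anti (by omega))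
  have h2 : ¬ HasChain U (n + 1) t := fun h' => hk _ (h'.anti (by omega))
  rw [decode_eq h2 (fun _ => special none .base), Function.iterate_succ_apply']
  simp only [step]
  rw [decode_eq h0 (fun _ => special none .base), decode_eq h1 (fun _ => special none .base)]

/-- The colours of a configuration. -/
def colours {N : ℕ} (x : Point 2 (Letter N)) : Point 2 (Fin (N + 1)) := fun t => colour (x t)

lemma measurable_colours {N : ℕ} : Measurable (colours (N := N)) :=
  measurable_pi_lambda _ fun t => (Measurable.of_discrete).comp (measurable_pi_apply t)

lemma colours_eq_of_step_eq_self {N : ℕ} {U : Point 2 (Fin (N + 1))} {x : Point 2 (Letter N)}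
    (h : step U x = x) : colours x = U := by
  funext t
  rw [← h]
  exact colour_fit _ _ _

/-! ### The decoded measure and its characterisation by colours -/

/-- The law of the decoded Bernoulli configuration. -/
noncomputable def triangleMeasure (N : ℕ) : Measure (Point 2 (Letter N)) :=
  (bernoulli N).map decode

instance (N : ℕ) : IsProbabilityMeasure (triangleMeasure N) :=
  Measure.isProbabilityMeasure_map measurable_decode.aemeasurable

lemma measurableSet_sft (N : ℕ) : MeasurableSet (triangleRules N).sft.carrier :=
  (triangleRules N).sft.isClosed.measurableSet

lemma ae_mem_sft {N : ℕ} (hN : 2 ≤ N) :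
    ∀ᵐ x ∂triangleMeasure N, x ∈ (triangleRules N).sft.carrier := by
  refine (ae_map_iff measurable_decode.aemeasurable (measurableSet_sft N)).2 ?_
  filter_upwards [ae_exists_not_hasChain hN] with U hU
  exact mem_sft_of_step_eq_self (step_decode hU)

lemma triangleMeasure_map_colours {N : ℕ} (hN : 2 ≤ N) :
    (triangleMeasure N).map colours = bernoulli N := by
  rw [triangleMeasure, Measure.map_map measurable_colours measurable_decode]
  conv_rhs => rw [← Measure.map_id (μ := bernoulli N)]
  refine Measure.map_congr ?_
  filter_upwards [ae_exists_not_hasChain hN] with U hU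
  exact colours_eq_of_step_eq_self (step_decode hU)

/-- A measure on the SFT with Bernoulli colours is unique. -/
lemma eq_triangleMeasure {N : ℕ} (hN : 2 ≤ N) {ν : Measure (Point 2 (Letter N))}
    (hX : ∀ᵐ x ∂ν, x ∈ (triangleRules N).sft.carrier) (hν : ν.map colours = bernoulli N) :
    ν = triangleMeasure N := by
  rw [triangleMeasure, ← hν, Measure.map_map measurable_decode measurable_colours]
  conv_lhs => rw [← Measure.map_id (μ := ν)]
  refine Measure.map_congr ?_
  have h := ae_exists_not_hasChain hN
  rw [← hν] at h
  filter_upwards [hX, ae_of_ae_map measurable_colours.aemeasurable h] with x hx hc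
  funext t
  obtain ⟨n, hn⟩ := hc t
  -- A point of the SFT is a fixed point of the update, so starting the iteration at `x` itself
  -- shows that decoding its colours returns `x`.
  have hs : step (colours x) x = x := step_eq_self hx
  have := decode_eq hn x
  rw [Function.iterate_fixed hs] at this
  exact this.symm

lemma measurePreserving_shift {N : ℕ} (hN : 2 ≤ N) (g : Fin 2 → ℤ) :
    MeasurePreserving (shift g) (triangleMeasure N) (triangleMeasure N) := by
  refine ⟨measurable_shift g, eq_triangleMeasure hN ?_ ?_⟩
  · refine (ae_map_iff (measurable_shift g).aemeasurable (measurableSet_sft N)).2 ?_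
    filter_upwards [ae_mem_sft hN] with x hx
    exact (triangleRules N).sft.mapsTo g hx
  · rw [Measure.map_map measurable_colours (measurable_shift g)]
    have : colours ∘ (shift g : Point 2 (Letter N) → _) = shift g ∘ colours := rfl
    rw [this, ← Measure.map_map (measurable_shift g) measurable_colours,
      triangleMeasure_map_colours hN, bernoulli_map_shift]

/-! ### The support and the failure of block gluing -/

/-- Points of the SFT with the same nonzero colour at a site have the same letter there. -/
lemma eq_of_colour_eq {N : ℕ} {x y : Point 2 (Letter N)}
    (hx : x ∈ (triangleRules N).sft.carrier) (hy : y ∈ (triangleRules N).sft.carrier)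
    {t : Fin 2 → ℤ} (h : colour (y t) = colour (x t)) (h0 : colour (x t) ≠ 0) : y t = x t := by
  rw [mem_sft_iff.1 hx t, mem_sft_iff.1 hy t, h]
  exact fit_of_ne_zero h0 _ _ _ _

/-- A point of the SFT whose special letters are all in the first quadrant is in the support. -/
lemma mem_support_triangleMeasure {N : ℕ} (hN : 2 ≤ N) {x : Point 2 (Letter N)}
    (hx : x ∈ (triangleRules N).sft.carrier)
    (hfree : ∀ t i, t i < 0 → colour (x t) ≠ 0) : x ∈ (triangleMeasure N).support := by
  rw [Measure.mem_support_iff_forall]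
  intro V hV
  obtain ⟨S, hSV⟩ : ∃ S : Finset (Fin 2 → ℤ),
      {y : Point 2 (Letter N) | ∀ s ∈ S, y s = x s} ⊆ V := by
    rw [nhds_pi, Filter.mem_pi'] at hV
    obtain ⟨I, W, hW, hIW⟩ := hV
    refine ⟨I, fun y hy => hIW fun i hi => ?_⟩
    rw [hy i hi]
    exact mem_of_mem_nhds (hW i)
  -- Inserting `(-1, -1)` pushes the left column and the bottom row of the box into the region where
  -- `x` is free; there equal colours already mean equal letters.
  obtain ⟨a, ha⟩ := (insert (fun _ => -1) S).bddBelow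
  obtain ⟨b, hb⟩ := S.bddAbove
  have ha0 : ∀ i, a i < 0 := fun i => by
    have : a i ≤ -1 := ha (Finset.mem_coe.2 (Finset.mem_insert_self _ _)) i
    omega
  have hm := measurableSet_pattern (Finset.Icc a b) (colours x)
  have hpos : 0 < triangleMeasure N
      (colours ⁻¹' {U | ∀ t ∈ Finset.Icc a b, U t = colours x t}) := by
    rw [← Measure.map_apply measurable_colours hm, triangleMeasure_map_colours hN,
      bernoulli_pattern]
    exact ENNReal.pow_pos (ENNReal.inv_pos.2 (by simp)) _
  refine hpos.trans_le (measure_mono_ae ?_)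
  filter_upwards [ae_mem_sft hN] with y hy hyc
  refine hSV fun s hs => ?_
  refine eqOn_of_colour_eq hy hx hyc (fun t ht i hi => ?_) s
    (Finset.mem_Icc.2 ⟨ha (by simp [hs]), hb hs⟩)
  exact eq_of_colour_eq hx hy (hyc t ht) (hfree t i (hi ▸ ha0 i))

lemma const_free_mem_sft {N : ℕ} (a : Fin N) :
    (fun _ => free a) ∈ (triangleRules N).sft.carrier :=
  fun _ _ => trivial

lemma not_blockGluing_support {N : ℕ} (hN : 2 ≤ N) :
    ¬ BlockGluing (triangleMeasure N).support := by
  rintro ⟨n, hn⟩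
  let a : Fin N := ⟨0, by omega⟩
  have hsub : (triangleMeasure N).support ⊆ (triangleRules N).sft.carrier :=
    Measure.support_subset_of_isClosed (triangleRules N).sft.isClosed (ae_mem_sft hN)
  have htri : trianglePoint a ∈ (triangleMeasure N).support := by
    refine mem_support_triangleMeasure hN (trianglePoint_mem_sft a) fun t i hi => ?_
    have : ¬ (0 ≤ t 0 ∧ t 0 ≤ t 1) := by
      match i with
      | 0 => omega
      | 1 => omega
    rw [trianglePoint, if_neg this]
    exact Fin.succ_ne_zero a
  have hfree : (fun _ => free a) ∈ (triangleMeasure N).support :=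
    mem_support_triangleMeasure hN (const_free_mem_sft a) fun t i hi => Fin.succ_ne_zero a
  -- The row of the triangle at height `n + 1` is to be glued to a free letter at the origin, at
  -- distance at least `n + 1`.
  obtain ⟨x, ⟨hx, hxu⟩, y, ⟨hy, hyu⟩, hxy⟩ := hn ![0, n + 1] ![n, n + 1] 0 0
    (by intro i; fin_cases i <;> simp) le_rfl
    _ ⟨_, htri, rfl⟩ _ ⟨_, hfree, rfl⟩ 0 (by
      intro s hs s' hs'
      have h1 : (n : ℤ) + 1 ≤ s 1 := (Finset.mem_Icc.1 hs).1 1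
      obtain rfl : s' = 0 := by simpa using hs'
      simp only [siteDist, Fin.sum_univ_two, sub_zero, Pi.zero_apply]
      have := abs_nonneg (s 0)
      have := le_abs_self (s 1)
      omega)
  rw [SymbolicDynamics.FullShift.shift_zero] at hxy
  subst hxy
  have hrow : IsTriangleRow y n (n + 1) := by
    have hag : ∀ i : ℤ, 0 ≤ i → i ≤ n → y ![i, n + 1] = trianglePoint a ![i, n + 1] := by
      intro i h0 h1
      refine congrFun hxu ⟨![i, n + 1], Finset.mem_Icc.2 ⟨?_, ?_⟩⟩ <;>
        (intro j; fin_cases j <;> simp [h0, h1])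
    have htr := isTriangleRow_trianglePoint a n
    exact ⟨fun i h0 h1 => by rw [hag i h0 h1.le]; exact htr.1 i h0 h1,
      by rw [hag n (by omega) le_rfl]; exact htr.2⟩
  have h0 := hrow.colour_eq_zero (hsub hx)
  have h1 : y 0 = free a := congrFun hyu ⟨0, by simp⟩
  have h2 : (![0, (n : ℤ) + 1 - n - 1] : Fin 2 → ℤ) = 0 := by
    ext j; fin_cases j <;> simp
  rw [h2, h1] at h0
  exact Fin.succ_ne_zero a h0

/-! ### The Gibbs inequality and finite entropy sums -/

lemma negMulLog_le {p q : ℝ} (hp : 0 ≤ p) (hq : 0 ≤ q) (hpq : q = 0 → p = 0) :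
    Real.negMulLog p ≤ -(p * Real.log q) + (q - p) := by
  rcases hp.eq_or_lt with rfl | hp
  · simpa using hq
  · have hq' : 0 < q := hq.lt_of_ne fun h => hp.ne' (hpq h.symm)
    have h1 : p * Real.log (q / p) ≤ p * (q / p - 1) :=
      mul_le_mul_of_nonneg_left (Real.log_le_sub_one_of_pos (by positivity)) hp.le
    rw [Real.log_div hq'.ne' hp.ne', mul_sub, mul_sub, mul_div_cancel₀ _ hp.ne'] at h1
    rw [Real.negMulLog]
    linarith

/-- The Gibbs inequality. -/
lemma sum_negMulLog_le {ι : Type*} (s : Finset ι) {p q : ι → ℝ} (hp : ∀ i ∈ s, 0 ≤ p i)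
    (hq : ∀ i ∈ s, 0 ≤ q i) (hpq : ∀ i ∈ s, q i = 0 → p i = 0)
    (hsum : ∑ i ∈ s, q i ≤ ∑ i ∈ s, p i) :
    ∑ i ∈ s, Real.negMulLog (p i) ≤ ∑ i ∈ s, -(p i * Real.log (q i)) := by
  have h := Finset.sum_le_sum fun i hi => negMulLog_le (hp i hi) (hq i hi) (hpq i hi)
  rw [Finset.sum_add_distrib, Finset.sum_sub_distrib] at h
  linarith

/-- A probability vector of maximal entropy is uniform. -/
lemma eq_inv_card_of_log_card_le {ι : Type*} [Fintype ι] [Nonempty ι] {p : ι → ℝ}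
    (hp : ∀ i, 0 ≤ p i) (hsum : ∑ i, p i = 1)
    (h : Real.log (Fintype.card ι) ≤ ∑ i, Real.negMulLog (p i)) (i : ι) :
    p i = (Fintype.card ι : ℝ)⁻¹ := by
  set q : ℝ := (Fintype.card ι : ℝ)⁻¹ with hq
  have hcard : (0 : ℝ) < Fintype.card ι := by exact_mod_cast Fintype.card_pos
  have hq0 : 0 < q := inv_pos.2 hcard
  have hle : ∀ i ∈ Finset.univ, Real.negMulLog (p i) ≤ -(p i * Real.log q) + (q - p i) :=
    fun i _ => negMulLog_le (hp i) hq0.le fun h => absurd h hq0.ne'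
  have htot : ∑ i, (-(p i * Real.log q) + (q - p i)) = Real.log (Fintype.card ι) := by
    rw [Finset.sum_add_distrib, Finset.sum_sub_distrib, Finset.sum_neg_distrib, ← Finset.sum_mul,
      hsum, Finset.sum_const, Finset.card_univ, nsmul_eq_mul, hq, mul_inv_cancel₀ hcard.ne',
      Real.log_inv]
    ring
  have heq := (Finset.sum_eq_sum_iff_of_le hle).1
    (le_antisymm (Finset.sum_le_sum hle) (htot.le.trans h)) i (Finset.mem_univ i)
  rcases (hp i).eq_or_lt with h0 | h0
  · rw [← h0] at heq
    simp at heq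
    exact absurd heq.symm hq0.ne'
  · by_contra hne
    have hne' : q / p i ≠ 1 := fun h' => hne ((div_eq_one_iff_eq h0.ne').1 h').symm
    have h1 : p i * Real.log (q / p i) < p i * (q / p i - 1) :=
      mul_lt_mul_of_pos_left (Real.log_lt_sub_one_of_pos (by positivity) hne') h0
    rw [Real.log_div hq0.ne' h0.ne', mul_sub, mul_sub, mul_div_cancel₀ _ h0.ne'] at h1
    rw [Real.negMulLog] at heq
    linarith

lemma integral_comp_finite {Ω ι : Type*} [MeasurableSpace Ω] [Fintype ι] [MeasurableSpace ι]
    [DiscreteMeasurableSpace ι] (ν : Measure Ω) [IsProbabilityMeasure ν] {f : Ω → ι}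
    (hf : Measurable f) (g : ι → ℝ) :
    ∫ x, g (f x) ∂ν = ∑ i, ν.real (f ⁻¹' {i}) * g i := by
  have := Measure.isProbabilityMeasure_map (μ := ν) hf.aemeasurable
  rw [← integral_map hf.aemeasurable (Measurable.of_discrete).aestronglyMeasurable,
    integral_fintype .of_finite]
  refine Finset.sum_congr rfl fun i _ => ?_
  rw [map_measureReal_apply hf (MeasurableSet.singleton i), smul_eq_mul]

lemma integrable_comp_finite {Ω ι : Type*} [MeasurableSpace Ω] [Finite ι] [MeasurableSpace ι]
    [DiscreteMeasurableSpace ι] (ν : Measure Ω) [IsProbabilityMeasure ν] {f : Ω → ι}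
    (hf : Measurable f) (g : ι → ℝ) : Integrable (fun x => g (f x)) ν := by
  have := Measure.isProbabilityMeasure_map (μ := ν) hf.aemeasurable
  exact (Integrable.of_finite (μ := ν.map f) (f := g)).comp_measurable hf

lemma sum_measureReal_preimage {Ω ι : Type*} [MeasurableSpace Ω] [Fintype ι] [MeasurableSpace ι]
    [DiscreteMeasurableSpace ι] (ν : Measure Ω) [IsProbabilityMeasure ν] {f : Ω → ι}
    (hf : Measurable f) : ∑ i, ν.real (f ⁻¹' {i}) = 1 := by
  simpa using (integral_comp_finite ν hf fun _ => 1).symm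

/-! ### Patterns on a box with given colours -/

lemma cyl_univ {d : ℕ} {A : Type*} {S : Finset (Fin d → ℤ)} (w : S → A) :
    cyl Set.univ w = (S.restrict : Point d A → S → A) ⁻¹' {w} := by
  ext x; simp [cyl]

lemma card_box (n : Fin 2 → ℕ) : (box n).card = n 0 * n 1 := by
  rw [box, Pi.card_Icc]
  simp

/-- The sites of a box in its left column or its bottom row. -/
noncomputable def boxEdge (n : Fin 2 → ℕ) : Finset (Fin 2 → ℤ) :=
  (box n).filter fun t => ∃ i, t i = 1

lemma card_boxEdge_le (n : Fin 2 → ℕ) : (boxEdge n).card ≤ n 0 + n 1 := by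
  have hsub : boxEdge n ⊆ (Finset.Icc 1 (n 0 : ℤ)).image (fun k => ![k, 1]) ∪
      (Finset.Icc 1 (n 1 : ℤ)).image (fun k => ![1, k]) := by
    intro t ht
    obtain ⟨ht, i, hi⟩ := Finset.mem_filter.1 ht
    have h := Finset.mem_Icc.1 ht
    rw [Finset.mem_union, Finset.mem_image, Finset.mem_image]
    match i with
    | 0 => exact .inr ⟨t 1, Finset.mem_Icc.2 ⟨h.1 1, h.2 1⟩, by
        ext j; fin_cases j <;> simp [hi]⟩
    | 1 => exact .inl ⟨t 0, Finset.mem_Icc.2 ⟨h.1 0, h.2 0⟩, by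
        ext j; fin_cases j <;> simp [hi]⟩
  refine (Finset.card_le_card hsub).trans ((Finset.card_union_le _ _).trans ?_)
  exact (add_le_add Finset.card_image_le Finset.card_image_le).trans (by simp)

variable {N : ℕ}

/-- The number of boundary conditions that determine a pattern on a box given its colours. -/
noncomputable def boundaryCount (N : ℕ) (n : Fin 2 → ℕ) : ℕ :=
  Fintype.card (Letter N) ^ (n 0 + n 1)

lemma boundaryCount_pos (n : Fin 2 → ℕ) : 0 < boundaryCount N n :=
  pow_pos (by rw [card_eq]; omega) _

-- By `eqOn_of_colour_eq` a pattern with colours `u` is determined by its letters on `boxEdge n`,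
-- which has at most `n 0 + n 1` sites.
open Classical in
lemma card_language_colour_le (n : Fin 2 → ℕ) (u : box n → Fin (N + 1)) :
    ((Finset.univ.filter fun w : box n → Letter N =>
      w ∈ language (triangleRules N).sft.carrier (box n)).filter
        fun w => (fun s => colour (w s)) = u).card ≤ boundaryCount N n := by
  have hE : ∀ s : boxEdge n, s.1 ∈ box n := fun s => (Finset.mem_filter.1 s.2).1
  have h := Finset.card_le_card_of_injOn
    (s := ((Finset.univ.filter fun w : box n → Letter N =>
      w ∈ language (triangleRules N).sft.carrier (box n)).filter
        fun w => (fun s => colour (w s)) = u))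
    (t := (Finset.univ : Finset (boxEdge n → Letter N)))
    (fun w s => w ⟨s.1, hE s⟩) (fun _ _ => Finset.mem_coe.2 (Finset.mem_univ _)) (by
      intro w hw w' hw' hww'
      simp only [Finset.coe_filter, Finset.mem_filter, Finset.mem_univ, true_and,
        Set.mem_ofPred_eq] at hw hw'
      obtain ⟨⟨x, hx, rfl⟩, hwu⟩ := hw
      obtain ⟨⟨y, hy, rfl⟩, hwu'⟩ := hw'
      funext s
      refine eqOn_of_colour_eq hx hy (fun t ht => ?_) (fun t ht i hi => ?_) s.1 s.2
      · exact congrFun (hwu.trans hwu'.symm) ⟨t, ht⟩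
      · exact congrFun hww' ⟨t, Finset.mem_filter.2 ⟨ht, i, hi⟩⟩)
  refine h.trans ?_
  rw [Finset.card_univ, Fintype.card_fun, Fintype.card_coe]
  exact Nat.pow_le_pow_right (by rw [card_eq]; omega) (card_boxEdge_le n)

open Classical in
/-- An upper bound for the entropy of the patterns on a box in terms of a subprobability vector
on the colour patterns. -/
lemma entropy_box_le {ν : Measure (Point 2 (Letter N))} [IsProbabilityMeasure ν]
    (hX : ∀ᵐ x ∂ν, x ∈ (triangleRules N).sft.carrier) (n : Fin 2 → ℕ)
    {r : (box n → Fin (N + 1)) → ℝ} (hr : ∀ u, 0 ≤ r u) (hr1 : ∑ u, r u ≤ 1)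
    (hr0 : ∀ u, r u = 0 → ν {x | (box n).restrict (colours x) = u} = 0) :
    ∑ w : box n → Letter N, Real.negMulLog (ν.real (cyl Set.univ w)) ≤
      Real.log (boundaryCount N n) + ∫ x, -Real.log (r ((box n).restrict (colours x))) ∂ν := by
  set K : ℝ := (boundaryCount N n : ℝ) with hK
  have hK0 : 0 < K := Nat.cast_pos.2 (boundaryCount_pos n)
  set p : (box n → Letter N) → ℝ := fun w => ν.real (cyl Set.univ w) with hp
  set col : (box n → Letter N) → (box n → Fin (N + 1)) := fun w s => colour (w s) with hcol
  set lang := Finset.univ.filter fun w : box n → Letter N =>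
      w ∈ language (triangleRules N).sft.carrier (box n) with hlang
  have hres : Measurable ((box n).restrict : Point 2 (Letter N) → _) :=
    Finset.measurable_restrict _
  have hp0 : ∀ w, w ∉ lang → p w = 0 := by
    intro w hw
    have : ν (cyl Set.univ w) = 0 := by
      refine measure_mono_null ?_ (ae_iff.1 hX)
      intro x hx hxX
      exact hw (Finset.mem_filter.2 ⟨Finset.mem_univ _, x, hxX, hx.2⟩)
    simp [hp, Measure.real, this]
  have hp1 : ∑ w, p w = 1 := by
    simp only [hp, cyl_univ]
    exact sum_measureReal_preimage ν hres
  have hsub : ∀ f : (box n → Letter N) → ℝ, (∀ w, w ∉ lang → f w = 0) →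
      ∑ w, f w = ∑ w ∈ lang, f w := fun f hf =>
    (Finset.sum_subset (Finset.subset_univ _) fun w _ hw => hf w hw).symm
  have hrp : ∀ w, r (col w) = 0 → p w = 0 := by
    intro w hw
    have : ν (cyl Set.univ w) = 0 := by
      refine measure_mono_null (fun x hx => ?_) (hr0 _ hw)
      obtain ⟨-, rfl⟩ := hx
      rfl
    simp [hp, Measure.real, this]
  -- The comparison vector for the Gibbs inequality gives each pattern the weight of its colours
  -- divided by `K`. As `K` bounds the number of patterns per colouring, the total is at most 1.
  have hq1 : ∑ w ∈ lang, r (col w) / K ≤ 1 := by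
    rw [← Finset.sum_fiberwise lang col]
    refine le_trans (Finset.sum_le_sum fun u _ => ?_) hr1
    rw [Finset.sum_congr rfl fun w hw => by rw [(Finset.mem_filter.1 hw).2], Finset.sum_const,
      nsmul_eq_mul, mul_div_assoc', div_le_iff₀ hK0, mul_comm]
    exact mul_le_mul_of_nonneg_left (Nat.cast_le.2 (card_language_colour_le n u)) (hr u)
  have hint : ∫ x, -Real.log (r ((box n).restrict (colours x))) ∂ν =
      ∑ w, p w * -Real.log (r (col w)) := by
    simp only [hp, cyl_univ]
    exact integral_comp_finite ν hres fun w => -Real.log (r (col w))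
  calc ∑ w, Real.negMulLog (p w) = ∑ w ∈ lang, Real.negMulLog (p w) :=
        hsub _ fun w hw => by rw [hp0 w hw, Real.negMulLog_zero]
    _ ≤ ∑ w ∈ lang, -(p w * Real.log (r (col w) / K)) := by
        refine sum_negMulLog_le _ (fun _ _ => measureReal_nonneg)
          (fun w _ => div_nonneg (hr _) hK0.le) (fun w _ h => hrp w ?_) ?_
        · exact (div_eq_zero_iff.1 h).resolve_right hK0.ne'
        · rwa [← hsub p hp0, hp1]
    _ = ∑ w, -(p w * Real.log (r (col w) / K)) :=
        (hsub _ fun w hw => by rw [hp0 w hw, zero_mul, neg_zero]).symm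
    _ = ∑ w, (p w * Real.log K + p w * -Real.log (r (col w))) := by
        refine Finset.sum_congr rfl fun w _ => ?_
        by_cases h : r (col w) = 0
        · simp [hrp w h]
        · rw [Real.log_div h hK0.ne']
          ring
    _ = _ := by
        rw [Finset.sum_add_distrib, ← Finset.sum_mul, hp1, one_mul, hint]

lemma log_boundaryCount (n : Fin 2 → ℕ) :
    Real.log (boundaryCount N n) = (n 0 + n 1) * Real.log (Fintype.card (Letter N)) := by
  rw [boundaryCount]
  push_cast
  rw [Real.log_pow]
  push_cast
  rfl

/-! ### Entropy of the SFT and of the decoded measure -/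

/-- A function of a box that is proportional to its volume up to a boundary term has the
proportionality constant as its density. -/
lemma tendsto_density {f : (Fin 2 → ℕ) → ℝ} {L c : ℝ}
    (hl : ∀ n, n 0 * n 1 * L ≤ f n) (hu : ∀ n, f n ≤ n 0 * n 1 * L + (n 0 + n 1) * c) :
    Tendsto (fun n : Fin 2 → ℕ => (∏ i, (n i : ℝ))⁻¹ * f n) atTop (𝓝 L) := by
  have hcoord : ∀ i, Tendsto (fun n : Fin 2 → ℕ => ((n i : ℝ))⁻¹) atTop (𝓝 0) := fun i =>
    tendsto_inv_atTop_zero.comp (tendsto_natCast_atTop_atTop.comp (tendsto_atTop.2 fun b =>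
      (eventually_ge_atTop fun _ => b).mono fun _ hn => hn i))
  have hlim : Tendsto (fun n : Fin 2 → ℕ => L + ((n 1 : ℝ)⁻¹ + (n 0 : ℝ)⁻¹) * c) atTop (𝓝 L) := by
    simpa using ((hcoord 1).add (hcoord 0)).mul_const c |>.const_add L
  have hev : ∀ᶠ n : Fin 2 → ℕ in atTop, 0 < (n 0 : ℝ) ∧ 0 < (n 1 : ℝ) := by
    filter_upwards [eventually_ge_atTop (1 : Fin 2 → ℕ)] with n hn
    have h0 : 1 ≤ n 0 := hn 0
    have h1 : 1 ≤ n 1 := hn 1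
    exact ⟨by exact_mod_cast h0, by exact_mod_cast h1⟩
  refine tendsto_of_tendsto_of_tendsto_of_le_of_le' tendsto_const_nhds hlim ?_ ?_
  · filter_upwards [hev] with n ⟨h0, h1⟩
    rw [Fin.prod_univ_two, ← div_eq_inv_mul, le_div_iff₀ (by positivity)]
    linarith [hl n]
  · filter_upwards [hev] with n ⟨h0, h1⟩
    rw [Fin.prod_univ_two, ← div_eq_inv_mul, div_le_iff₀ (by positivity)]
    refine (hu n).trans (le_of_eq ?_)
    field_simp

/-- A colour pattern has positive Bernoulli measure, so some configuration extending it has only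
finite chains and can be decoded. -/
lemma exists_mem_sft_colours (hN : 2 ≤ N) (S : Finset (Fin 2 → ℤ))
    (u : Point 2 (Fin (N + 1))) :
    ∃ x ∈ (triangleRules N).sft.carrier, ∀ s ∈ S, colours x s = u s := by
  have hpos : 0 < bernoulli N {U | ∀ s ∈ S, U s = u s} := by
    rw [bernoulli_pattern]
    exact ENNReal.pow_pos (ENNReal.inv_pos.2 (by simp)) _
  obtain ⟨U, hU, hc⟩ := Measure.exists_mem_of_measure_ne_zero_of_ae hpos.ne'
    (ae_restrict_of_ae (ae_exists_not_hasChain hN))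
  refine ⟨decode U, mem_sft_of_step_eq_self (step_decode hc), fun s hs => ?_⟩
  rw [colours_eq_of_step_eq_self (step_decode hc)]
  exact hU s hs

open Classical in
lemma card_language_bounds (hN : 2 ≤ N) (n : Fin 2 → ℕ) :
    (N + 1) ^ (n 0 * n 1) ≤ (language (triangleRules N).sft.carrier (box n)).ncard ∧
    (language (triangleRules N).sft.carrier (box n)).ncard ≤
      (N + 1) ^ (n 0 * n 1) * boundaryCount N n := by
  set lang := Finset.univ.filter fun w : box n → Letter N =>
      w ∈ language (triangleRules N).sft.carrier (box n) with hlang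
  have hcard : (language (triangleRules N).sft.carrier (box n)).ncard = lang.card := by
    rw [← Set.ncard_coe_finset]
    congr 1
    ext w
    simp [hlang]
  have hu : Fintype.card (box n → Fin (N + 1)) = (N + 1) ^ (n 0 * n 1) := by
    rw [Fintype.card_fun, Fintype.card_fin, Fintype.card_coe, card_box]
  rw [hcard, ← hu]
  set col : (box n → Letter N) → (box n → Fin (N + 1)) := fun w s => colour (w s) with hcol
  constructor
  · refine Finset.card_le_card_of_surjOn col fun u _ => ?_
    obtain ⟨x, hx, hxu⟩ := exists_mem_sft_colours hN (box n)
      fun s => if h : s ∈ box n then u ⟨s, h⟩ else 0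
    refine ⟨(box n).restrict x, ?_, ?_⟩
    · simp only [hlang, Finset.coe_filter, Finset.mem_univ, true_and]
      exact ⟨x, hx, rfl⟩
    · funext s
      have := hxu s.1 s.2
      rwa [dif_pos s.2] at this
  · rw [Finset.card_eq_sum_card_fiberwise (f := col) (t := Finset.univ) (by simp)]
    refine (Finset.sum_le_card_nsmul _ _ _ fun u _ => card_language_colour_le n u).trans ?_
    rw [smul_eq_mul, Finset.card_univ]

lemma hasTopEntropy_sft (hN : 2 ≤ N) :
    HasTopEntropy (triangleRules N).sft.carrier (Real.log (N + 1)) := by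
  refine tendsto_density (c := Real.log (Fintype.card (Letter N))) (fun n => ?_) (fun n => ?_)
  · have h : (((N + 1) ^ (n 0 * n 1) : ℕ) : ℝ) ≤ _ := Nat.cast_le.2 (card_language_bounds hN n).1
    have h2 := Real.log_le_log (by positivity) h
    push_cast at h2
    rw [Real.log_pow] at h2
    push_cast at h2
    exact h2
  · have h : (_ : ℝ) ≤ (((N + 1) ^ (n 0 * n 1) * boundaryCount N n : ℕ) : ℝ) :=
      Nat.cast_le.2 (card_language_bounds hN n).2
    have hpos : 0 < (language (triangleRules N).sft.carrier (box n)).ncard :=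
      lt_of_lt_of_le (by positivity) (card_language_bounds hN n).1
    have h2 := Real.log_le_log (by exact_mod_cast hpos) h
    have hK : (boundaryCount N n : ℝ) ≠ 0 := by exact_mod_cast (boundaryCount_pos n).ne'
    push_cast at h2
    rw [Real.log_mul (by positivity) hK, Real.log_pow, log_boundaryCount] at h2
    push_cast at h2
    exact h2

lemma hasMeasureEntropy_triangleMeasure (hN : 2 ≤ N) :
    HasMeasureEntropy (triangleMeasure N) (Real.log (N + 1)) := by
  refine tendsto_density (c := Real.log (Fintype.card (Letter N))) (fun n => ?_) (fun n => ?_)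
  · set p : (box n → Letter N) → ℝ := fun w => (triangleMeasure N).real (cyl Set.univ w) with hp
    have hp1 : ∑ w, p w = 1 := by
      simp only [hp, cyl_univ]
      exact sum_measureReal_preimage _ (Finset.measurable_restrict _)
    -- A cylinder of letters is contained in the cylinder of its colours.
    have hple : ∀ w, p w ≤ ((N : ℝ) + 1)⁻¹ ^ (n 0 * n 1) := by
      intro w
      set u : Point 2 (Fin (N + 1)) :=
        fun s => if h : s ∈ box n then colour (w ⟨s, h⟩) else 0 with hu
      have hm := measurableSet_pattern (box n) u
      have h1 : triangleMeasure N (cyl Set.univ w) ≤ ((N : ENNReal) + 1)⁻¹ ^ (n 0 * n 1) := by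
        rw [← card_box, ← bernoulli_pattern (box n) u, ← triangleMeasure_map_colours hN,
          Measure.map_apply measurable_colours hm]
        refine measure_mono fun x hx s hs => ?_
        obtain ⟨-, rfl⟩ := hx
        simp [hu, hs, colours]
      have h2 := ENNReal.toReal_mono (by simp) h1
      rw [ENNReal.toReal_pow, ENNReal.toReal_inv] at h2
      exact h2
    calc (n 0 * n 1 : ℝ) * Real.log (N + 1)
        = ∑ w, p w * (n 0 * n 1 * Real.log (N + 1)) := by rw [← Finset.sum_mul, hp1, one_mul]
      _ ≤ ∑ w, Real.negMulLog (p w) := by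
        refine Finset.sum_le_sum fun w _ => ?_
        have hp0 : 0 ≤ p w := measureReal_nonneg
        rcases hp0.eq_or_lt with h | h
        · rw [← h]; simp
        · have h3 := Real.log_le_log h (hple w)
          rw [Real.log_pow, Real.log_inv] at h3
          push_cast at h3
          have h4 := mul_le_mul_of_nonneg_left h3 hp0
          rw [Real.negMulLog]
          linarith
  · set q : ℝ := ((N : ℝ) + 1)⁻¹ ^ (n 0 * n 1) with hq
    have hq0 : 0 < q := by positivity
    -- The uniform vector on colour patterns gives the matching upper bound.
    have h := entropy_box_le (ae_mem_sft hN) n (r := fun _ => q) (fun _ => hq0.le) (by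
      rw [Finset.sum_const, Finset.card_univ, Fintype.card_fun, Fintype.card_fin,
        Fintype.card_coe, card_box, nsmul_eq_mul, hq, inv_pow]
      push_cast
      exact (mul_inv_cancel₀ (by positivity)).le) (fun _ h => absurd h hq0.ne')
    rw [integral_const, log_boundaryCount, hq, Real.log_pow, Real.log_inv] at h
    push_cast at h
    simp only [probReal_univ, one_smul] at h
    linarith

lemma isMME_triangleMeasure (hN : 2 ≤ N) : IsMME (triangleRules N).sft (triangleMeasure N) where
  prob := inferInstance
  invariant := measurePreserving_shift hN
  support_subset :=
    Measure.support_subset_of_isClosed (triangleRules N).sft.isClosed (ae_mem_sft hN)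
  entropy_eq := ⟨_, hasTopEntropy_sft hN, hasMeasureEntropy_triangleMeasure hN⟩

/-! ### Uniqueness of the measure of maximal entropy -/

/-- The sites of the square tile of side length `m` with lower left corner `a`. -/
def tileSite {m : ℕ} (a : Fin 2 → ℤ) (i : Fin 2 → Fin m) : Fin 2 → ℤ := fun l => a l + (i l : ℕ)

/-- The pattern of `x` on the square tile of side length `m` with lower left corner `a`. -/
def tile (m : ℕ) {C : Type*} (a : Fin 2 → ℤ) (x : Point 2 C) : (Fin 2 → Fin m) → C :=
  fun i => x (tileSite a i)

lemma measurable_tile (m : ℕ) {C : Type*} [MeasurableSpace C] (a : Fin 2 → ℤ) :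
    Measurable (tile m a : Point 2 C → _) :=
  measurable_pi_lambda _ fun _ => measurable_pi_apply _

lemma tileSite_injective {m : ℕ} (a : Fin 2 → ℤ) :
    Function.Injective (tileSite (m := m) a) := by
  intro i j h
  funext l
  have := congrFun h l
  simp only [tileSite] at this
  exact Fin.ext (by omega)

lemma measure_tile_eq {ν : Measure (Point 2 (Letter N))}
    (hinv : ∀ t : Fin 2 → ℤ, MeasurePreserving (shift t) ν ν) (m : ℕ) (a b : Fin 2 → ℤ)
    (v : (Fin 2 → Fin m) → Fin (N + 1)) :
    ν.real ((fun x => tile m a (colours x)) ⁻¹' {v}) =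
      ν.real ((fun x => tile m b (colours x)) ⁻¹' {v}) := by
  have hm : MeasurableSet ((fun x : Point 2 (Letter N) => tile m b (colours x)) ⁻¹' {v}) :=
    ((measurable_tile m b).comp measurable_colours) (MeasurableSet.singleton v)
  rw [Measure.real, Measure.real, ← (hinv (a - b)).measure_preimage hm.nullMeasurableSet]
  congr 2
  ext x
  have : tile m b (colours (shift (a - b) x)) = tile m a (colours x) := by
    funext i
    simp only [tile, colours, SymbolicDynamics.FullShift.shift]
    congr 2
    funext l
    simp only [tileSite, Pi.add_apply, Pi.sub_apply]
    ring
  simp only [Set.mem_preimage, this]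

/-- The lower left corner of the tile with index `j` in the tiling of a box. -/
def corner (m : ℕ) {k : ℕ} (j : Fin 2 → Fin k) : Fin 2 → ℤ := fun l => 1 + m * (j l : ℕ)

lemma tileSite_mem_box {m k : ℕ} (j : Fin 2 → Fin k) (i : Fin 2 → Fin m) :
    tileSite (corner m j) i ∈ box (fun _ : Fin 2 => k * m) := by
  refine Finset.mem_Icc.2 ⟨fun l => ?_, fun l => ?_⟩
  · simp only [tileSite, corner]
    exact le_add_of_le_of_nonneg (le_add_of_nonneg_right (by positivity)) (by positivity)
  · simp only [tileSite, corner]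
    have h1 : (j l : ℕ) + 1 ≤ k := (j l).2
    have h2 : (i l : ℕ) + 1 ≤ m := (i l).2
    have h3 := Nat.mul_le_mul_right m h1
    push_cast
    zify at h3 h2
    linarith

lemma exists_tileSite_eq {m k : ℕ} {s : Fin 2 → ℤ} (hs : s ∈ box (fun _ : Fin 2 => k * m)) :
    ∃ (j : Fin 2 → Fin k) (i : Fin 2 → Fin m), tileSite (corner m j) i = s := by
  have h : ∀ l, ∃ (j : Fin k) (i : Fin m), 1 + (m : ℤ) * (j : ℕ) + (i : ℕ) = s l := by
    intro l
    have h1 : 1 ≤ s l := (Finset.mem_Icc.1 hs).1 l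
    have h2 : s l ≤ ((k * m : ℕ) : ℤ) := (Finset.mem_Icc.1 hs).2 l
    obtain ⟨c, hc⟩ := Int.eq_ofNat_of_zero_le (sub_nonneg.2 h1)
    have hcm : c < k * m := by zify; push_cast at h2; omega
    have hm : 0 < m := Nat.pos_of_mul_pos_left (Nat.zero_lt_of_lt hcm)
    refine ⟨⟨c / m, (Nat.div_lt_iff_lt_mul hm).2 hcm⟩, ⟨c % m, Nat.mod_lt _ hm⟩, ?_⟩
    have := Nat.div_add_mod c m
    zify at this
    simp only
    push_cast
    linarith
  choose j i h using h
  exact ⟨j, i, funext h⟩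

/-- Subadditivity of entropy, up to the boundary term: in `entropy_box_le`, take for `r` the product
of the law of one tile over the `k ^ 2` tiles of the box. No independence is needed, since the
logarithm turns the product into a sum and shift invariance makes every summand the entropy of one
tile. -/
lemma entropy_box_le_tiles {ν : Measure (Point 2 (Letter N))} [IsProbabilityMeasure ν]
    (hinv : ∀ t : Fin 2 → ℤ, MeasurePreserving (shift t) ν ν)
    (hX : ∀ᵐ x ∂ν, x ∈ (triangleRules N).sft.carrier) (m k : ℕ) (a : Fin 2 → ℤ) :
    ∑ w : box (fun _ : Fin 2 => k * m) → Letter N, Real.negMulLog (ν.real (cyl Set.univ w)) ≤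
      2 * (k * m) * Real.log (Fintype.card (Letter N)) +
        k ^ 2 * ∑ v, Real.negMulLog (ν.real ((fun x => tile m a (colours x)) ⁻¹' {v})) := by
  set ρ : ((Fin 2 → Fin m) → Fin (N + 1)) → ℝ :=
    fun v => ν.real ((fun x => tile m a (colours x)) ⁻¹' {v}) with hρ
  have hρ0 : ∀ v, 0 ≤ ρ v := fun v => measureReal_nonneg
  have hmeas : ∀ b, Measurable fun x : Point 2 (Letter N) => tile m b (colours x) := fun b =>
    (measurable_tile m b).comp measurable_colours
  have hρ1 : ∑ v, ρ v = 1 := sum_measureReal_preimage ν (hmeas a)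
  let T : (box (fun _ : Fin 2 => k * m) → Fin (N + 1)) →
      (Fin 2 → Fin k) → (Fin 2 → Fin m) → Fin (N + 1) :=
    fun u j i => u ⟨tileSite (corner m j) i, tileSite_mem_box j i⟩
  have hT : Function.Injective T := by
    intro u u' h
    funext ⟨s, hs⟩
    obtain ⟨j, i, rfl⟩ := exists_tileSite_eq hs
    exact congrFun (congrFun h j) i
  have hTx : ∀ (x : Point 2 (Letter N)) j,
      T ((box (fun _ : Fin 2 => k * m)).restrict (colours x)) j =
        tile m (corner m j) (colours x) := fun _ _ => rfl
  have hnull : ∀ (j : Fin 2 → Fin k) v, ρ v = 0 → ν {x | tile m (corner m j) (colours x) = v} = 0 := by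
    intro j v hv
    have h1 := measure_tile_eq hinv m (corner m j) a v
    rw [show ν.real ((fun x => tile m a (colours x)) ⁻¹' {v}) = 0 from hv,
      measureReal_eq_zero_iff] at h1
    exact h1
  have h := entropy_box_le hX (fun _ : Fin 2 => k * m) (r := fun u => ∏ j, ρ (T u j))
    (fun u => Finset.prod_nonneg fun j _ => hρ0 _) (by
      calc ∑ u, ∏ j, ρ (T u j)
          = ∑ f ∈ Finset.univ.map ⟨T, hT⟩, ∏ j, ρ (f j) := by rw [Finset.sum_map]; rfl
        _ ≤ ∑ f : (Fin 2 → Fin k) → (Fin 2 → Fin m) → Fin (N + 1), ∏ j, ρ (f j) :=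
          Finset.sum_le_univ_sum_of_nonneg fun f => Finset.prod_nonneg fun j _ => hρ0 _
        _ = ∏ _j : Fin 2 → Fin k, ∑ v, ρ v := by
          rw [Finset.prod_univ_sum, Fintype.piFinset_univ]
        _ ≤ 1 := by simp [hρ1]) (by
      intro u hu
      obtain ⟨j, -, hj⟩ := Finset.prod_eq_zero_iff.1 hu
      refine measure_mono_null (fun x hx => ?_) (hnull j _ hj)
      rw [Set.mem_ofPred_eq, ← hTx, show _ = u from hx])
  refine h.trans (add_le_add (le_of_eq ?_) (le_of_eq ?_))
  · rw [log_boundaryCount]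
    push_cast
    ring
  -- The logarithm of the product splits only when no factor vanishes.
  have hae : ∀ᵐ x ∂ν, ∀ j : Fin 2 → Fin k, ρ (tile m (corner m j) (colours x)) ≠ 0 := by
    rw [ae_all_iff]
    intro j
    have : {x : Point 2 (Letter N) | ¬ ρ (tile m (corner m j) (colours x)) ≠ 0} ⊆
        ⋃ v : {v // ρ v = 0}, {x | tile m (corner m j) (colours x) = v} := fun x hx =>
      Set.mem_iUnion.2 ⟨⟨_, not_not.1 hx⟩, rfl⟩
    exact measure_mono_null this (measure_iUnion_null fun v => hnull j v v.2)
  calc _ = ∫ x, ∑ j : Fin 2 → Fin k, -Real.log (ρ (tile m (corner m j) (colours x))) ∂ν := by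
        refine integral_congr_ae ?_
        filter_upwards [hae] with x hx
        simp only [hTx]
        rw [Real.log_prod fun j _ => hx j, Finset.sum_neg_distrib]
    _ = ∑ j : Fin 2 → Fin k, ∫ x, -Real.log (ρ (tile m (corner m j) (colours x))) ∂ν :=
        integral_finsetSum _ fun j _ =>
          integrable_comp_finite ν (hmeas (corner m j)) fun v => -Real.log (ρ v)
    _ = ∑ _j : Fin 2 → Fin k, ∑ v, Real.negMulLog (ρ v) := by
        refine Finset.sum_congr rfl fun j _ => ?_
        rw [integral_comp_finite ν (hmeas (corner m j)) fun v => -Real.log (ρ v)]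
        refine Finset.sum_congr rfl fun v _ => ?_
        rw [measure_tile_eq hinv m (corner m j) a v, Real.negMulLog]
        simp only [hρ]
        ring
    _ = _ := by simp [hρ]

/-- The colours under a measure of maximal entropy are Bernoulli on every tile. -/
lemma measure_tile_of_hasMeasureEntropy {ν : Measure (Point 2 (Letter N))}
    [IsProbabilityMeasure ν] (hinv : ∀ t : Fin 2 → ℤ, MeasurePreserving (shift t) ν ν)
    (hX : ∀ᵐ x ∂ν, x ∈ (triangleRules N).sft.carrier)
    (hent : HasMeasureEntropy ν (Real.log (N + 1))) {m : ℕ} (hm : 0 < m) (a : Fin 2 → ℤ)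
    (v : (Fin 2 → Fin m) → Fin (N + 1)) :
    ν.real ((fun x => tile m a (colours x)) ⁻¹' {v}) = ((N : ℝ) + 1)⁻¹ ^ (m ^ 2) := by
  set ρ : ((Fin 2 → Fin m) → Fin (N + 1)) → ℝ :=
    fun v => ν.real ((fun x => tile m a (colours x)) ⁻¹' {v}) with hρ
  set c := Real.log (Fintype.card (Letter N)) with hc
  have hm' : (0 : ℝ) < m := by exact_mod_cast hm
  have hcard : (Fintype.card ((Fin 2 → Fin m) → Fin (N + 1)) : ℝ) = ((N : ℝ) + 1) ^ (m ^ 2) := by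
    simp
  have hto : Tendsto (fun k : ℕ => fun _ : Fin 2 => k * m) atTop atTop :=
    tendsto_atTop.2 fun b => by
      filter_upwards [eventually_ge_atTop (b 0 + b 1)] with k hk l
      have : b l ≤ k := by fin_cases l <;> simp <;> omega
      exact this.trans (Nat.le_mul_of_pos_right _ hm)
  have h1 := hent.comp hto
  have h2 : Tendsto (fun k : ℕ => 2 * c / m * (k : ℝ)⁻¹ +
      (∑ v, Real.negMulLog (ρ v)) / m ^ 2) atTop (𝓝 ((∑ v, Real.negMulLog (ρ v)) / m ^ 2)) := by
    simpa using (tendsto_inv_atTop_nhds_zero_nat (𝕜 := ℝ)).const_mul (2 * c / m) |>.add_const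
      ((∑ v, Real.negMulLog (ρ v)) / m ^ 2)
  -- Along boxes of side `k * m` the boundary term is of order `k * m`, so it vanishes after
  -- division by the volume. A tile then has at least the entropy of the uniform law, which forces
  -- equality.
  have h3 : Real.log (N + 1) ≤ (∑ v, Real.negMulLog (ρ v)) / m ^ 2 := by
    refine le_of_tendsto_of_tendsto h1 h2 ?_
    filter_upwards [eventually_gt_atTop 0] with k hk
    have hk' : (0 : ℝ) < k := by exact_mod_cast hk
    have h4 := entropy_box_le_tiles hinv hX m k a
    simp only [Function.comp_apply, Fin.prod_univ_two]
    push_cast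
    rw [← div_eq_inv_mul, div_le_iff₀ (by positivity)]
    refine h4.trans (le_of_eq ?_)
    field_simp
    rfl
  rw [show ν.real _ = ρ v from rfl, eq_inv_card_of_log_card_le (p := ρ)
    (fun _ => measureReal_nonneg)
    (sum_measureReal_preimage ν ((measurable_tile m a).comp measurable_colours)) ?_ v, hcard,
    inv_pow]
  rw [hcard, Real.log_pow]
  rw [le_div_iff₀ (by positivity)] at h3
  push_cast
  linarith

lemma map_colours_of_hasMeasureEntropy {ν : Measure (Point 2 (Letter N))}
    [IsProbabilityMeasure ν] (hinv : ∀ t : Fin 2 → ℤ, MeasurePreserving (shift t) ν ν)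
    (hX : ∀ᵐ x ∂ν, x ∈ (triangleRules N).sft.carrier)
    (hent : HasMeasureEntropy ν (Real.log (N + 1))) : ν.map colours = bernoulli N := by
  refine Measure.eq_infinitePi _ fun s t ht => ?_
  obtain ⟨a, ha⟩ := s.bddBelow
  obtain ⟨b, hb⟩ := s.bddAbove
  -- A side long enough in both directions for one square tile to cover `s`.
  set m : ℕ := (b 0 - a 0).toNat + (b 1 - a 1).toNat + 1 with hm
  have hsite : ∀ r ∈ s, ∃ i : Fin 2 → Fin m, tileSite a i = r := by
    intro r hr
    have h0 : ∀ l, a l ≤ r l := fun l => ha hr l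
    have h1 : ∀ l, r l ≤ b l := fun l => hb hr l
    refine ⟨fun l => ⟨(r l - a l).toNat, ?_⟩, funext fun l => ?_⟩
    · have h00 := h0 0
      have h01 := h0 1
      have h10 := h1 0
      have h11 := h1 1
      match l with
      | 0 => omega
      | 1 => omega
    · have := h0 l
      simp only [tileSite]
      omega
  have hpat : ∀ v : (Fin 2 → Fin m) → Fin (N + 1),
      bernoulli N (tile m a ⁻¹' {v}) = ((N : ENNReal) + 1)⁻¹ ^ (m ^ 2) := by
    intro v
    have h1 := bernoulli_pattern (N := N)
      (Finset.univ.map ⟨tileSite (m := m) a, tileSite_injective a⟩)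
      (Function.extend (tileSite a) v 0)
    rw [Finset.card_map, Finset.card_univ, Fintype.card_fun, Fintype.card_fin,
      Fintype.card_fin] at h1
    rw [← h1]
    congr 1
    ext U
    constructor
    · rintro rfl r hr
      obtain ⟨i, -, rfl⟩ := Finset.mem_map.1 hr
      exact ((tileSite_injective a).extend_apply (tile m a U) 0 i).symm
    · intro h
      funext i
      exact (h (tileSite a i) (Finset.mem_map.2 ⟨i, Finset.mem_univ _, rfl⟩)).trans
        ((tileSite_injective a).extend_apply v 0 i)
  have hlaw : (ν.map colours).map (tile m a) = (bernoulli N).map (tile m a) := by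
    refine Measure.ext_of_singleton fun v => ?_
    rw [Measure.map_apply (measurable_tile m a) (MeasurableSet.singleton v),
      Measure.map_apply (measurable_tile m a) (MeasurableSet.singleton v), hpat,
      Measure.map_apply measurable_colours
        (measurable_tile m a (MeasurableSet.singleton v))]
    have h := measure_tile_of_hasMeasureEntropy hinv hX hent (Nat.succ_pos _ : 0 < m) a v
    rw [← ENNReal.toReal_eq_toReal_iff' (by simp) (by simp)]
    rw [ENNReal.toReal_pow, ENNReal.toReal_inv]
    exact h
  have hset : Set.pi (s : Set (Fin 2 → ℤ)) t =
      tile m a ⁻¹' {v | ∀ i, tileSite a i ∈ s → v i ∈ t (tileSite a i)} := by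
    ext U
    constructor
    · exact fun h i hi => h _ hi
    · intro h r hr
      obtain ⟨i, rfl⟩ := hsite r hr
      exact h i hr
  rw [hset, ← Measure.map_apply (measurable_tile m a) MeasurableSet.of_discrete, hlaw,
    Measure.map_apply (measurable_tile m a) MeasurableSet.of_discrete, ← hset, bernoulli,
    Measure.infinitePi_pi _ fun i _ => ht i]

lemma eq_triangleMeasure_of_isMME (hN : 2 ≤ N) {ν : Measure (Point 2 (Letter N))}
    (hν : IsMME (triangleRules N).sft ν) : ν = triangleMeasure N := by
  have := hν.prob
  obtain ⟨h, htop, hent⟩ := hν.entropy_eq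
  obtain rfl := tendsto_nhds_unique htop (hasTopEntropy_sft hN)
  have hX : ∀ᵐ x ∂ν, x ∈ (triangleRules N).sft.carrier := by
    filter_upwards [Measure.support_mem_ae (μ := ν)] with x hx
    exact hν.support_subset hx
  exact eq_triangleMeasure hN hX (map_colours_of_hasMeasureEntropy hν.invariant hX hent)

end NearlyFull

theorem mainTheorem8 (ε : ℝ) (hε : 0 < ε) :
    ∃ (A : Type) (_ : Fintype A) (_ : TopologicalSpace A) (_ : DiscreteTopology A)
      (_ : MeasurableSpace A) (_ : BorelSpace A) (R : NearlyFull.NNRules 2 A),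
      R.IsFull ε ∧
      ∃ μ : MeasureTheory.Measure (NearlyFull.Point 2 A),
        NearlyFull.IsMME R.sft μ ∧
        (∀ ν : MeasureTheory.Measure (NearlyFull.Point 2 A),
          NearlyFull.IsMME R.sft ν → ν = μ) ∧
        ¬ NearlyFull.BlockGluing μ.support := by
  -- Taking `N = k + 2` ensures `2 ≤ N`, which makes chains of special letters subcritical.
  obtain ⟨k, hk⟩ := exists_nat_gt (12 / ε)
  have hN : 2 ≤ k + 2 := by omega
  have hfull : 12 < ε * (((k + 2 : ℕ) : ℝ) + 12) := by
    rw [div_lt_iff₀ hε] at hk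
    push_cast
    nlinarith
  exact ⟨NearlyFull.Letter (k + 2), inferInstance, inferInstance, inferInstance, inferInstance,
    inferInstance, NearlyFull.triangleRules (k + 2), NearlyFull.isFull_triangleRules hfull,
    NearlyFull.triangleMeasure (k + 2), NearlyFull.isMME_triangleMeasure hN,
    fun ν hν => NearlyFull.eq_triangleMeasure_of_isMME hN hν,
    NearlyFull.not_blockGluing_support hN⟩
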